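/- Let $k\ge 1$ be an integer. Let $\boldsymbol{A}\in\mathbb{R}^{m\times n}$ have full column rank, with QR factorization $\boldsymbol{A}=\boldsymbol{Q}\boldsymbol{R}$, where $\boldsymbol{Q}\in\mathbb{R}^{m\times n}$ satisfies $\boldsymbol{Q}^{\top}\boldsymbol{Q}=\boldsymbol{I}_n$ and $\boldsymbol{R}=(r_{ij})\in\mathbb{R}^{n\times n}$ is nonsingular and upper triangular. The matrix $\boldsymbol{A}$ is called KZ (Korkine--Zolotareff) reduced if $$|r_{ij}|\le \tfrac12 |r_{ii}|\quad (1\le i<j\le n),\qquad |r_{ii}|=\min_{\boldsymbol{x}\in\mathbb{Z}^{n-i+1}\setminus\{\boldsymbol{0}\}}\|\boldsymbol{R}_{i:n,i:n}\boldsymbol{x}\|_2\quad (1\le i\le n),$$ where $\boldsymbol{R}_{i:n,i:n}$ is the submatrix of $\boldsymbol{R}$ with row and column indices from $i$ to $n$. Schnorr's constant is $$\beta_k=\sup_{\boldsymbol{A}}\left|\frac{\prod_{i=1}^{k}r_{ii}}{\prod_{i=k+1}^{2k}r_{ii}}\right|^{2/k},$$ where the supremum is over all KZ reduced real $m\times 2k$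 matrices $\boldsymbol{A}$ of full column rank ($m$ arbitrary) and $r_{ii}$ are the diagonal entries of the R-factor $\boldsymbol{R}$ of $\boldsymbol{A}$. Then for every integer $k\ge 5$ the supremum $\beta_k$ is finite and $$\beta_k\le 0.08698\, e^{18/k}\,(k-0.5)^{2\ln 2}.$$ -/

import Mathlib

/-- `A = Q R` is a (thin) QR factorization of the real `m × n` matrix `A`: the columns of `Q` are
orthonormal and `R` is a nonsingular upper triangular matrix (the R-factor). The signs of the
diagonal entries of `R` are not normalized. -/
structure IsQRFactorization {m n : ℕ} (A Q : Matrix (Fin m) (Fin n) ℝ)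
    (R : Matrix (Fin n) (Fin n) ℝ) : Prop where
  eq_mul : A = Q * R
  orthonormal : Q.transpose * Q = 1
  upper : ∀ i j : Fin n, j < i → R i j = 0
  nonsingular : R.det ≠ 0

/-- The lower right block of `R` formed by the rows and columns with index at least `i`. -/
def tailBlock {n : ℕ} (R : Matrix (Fin n) (Fin n) ℝ) (i : Fin n) :
    Matrix {j : Fin n // i ≤ j} {j : Fin n // i ≤ j} ℝ :=
  R.submatrix Subtype.val Subtype.val

/-- The Korkine–Zolotareff conditions on an R-factor: `R` is size reduced, and each `|r_ii|` is
the minimum of the Euclidean norms `‖R_{i:n,i:n} x‖₂` over nonzero integer vectors `x`. -/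
structure IsKZReducedFactor {n : ℕ} (R : Matrix (Fin n) (Fin n) ℝ) : Prop where
  size_reduced : ∀ i j : Fin n, i < j → |R i j| ≤ 1 / 2 * |R i i|
  minimal : ∀ i : Fin n,
    IsLeast {l : ℝ | ∃ x : {j : Fin n // i ≤ j} → ℤ, x ≠ 0 ∧
      l = ‖WithLp.toLp 2 ((tailBlock R i).mulVec (fun j => (x j : ℝ)))‖} |R i i|

/-- The values `(∏_{i ≤ k} r_ii / ∏_{k < i ≤ 2k} r_ii)^(2/k)` where `R` is the R-factor of a KZ
reduced real `m × 2k` matrix `A` of full column rank, for any number of rows `m`. The absolute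
value makes the value independent of the choice of the signs of the diagonal of `R`. -/
def schnorrRatios (k : ℕ) : Set ℝ :=
  {b : ℝ | ∃ (m : ℕ) (A Q : Matrix (Fin m) (Fin (2 * k)) ℝ)
      (R : Matrix (Fin (2 * k)) (Fin (2 * k)) ℝ),
    A.rank = 2 * k ∧ IsQRFactorization A Q R ∧ IsKZReducedFactor R ∧
    b = |(∏ i : Fin (2 * k) with i.val < k, R i i) /
          (∏ i : Fin (2 * k) with k ≤ i.val, R i i)| ^ (2 / (k : ℝ))}

/-- Schnorr's constant `β_k`. -/
noncomputable def schnorrConstant (k : ℕ) : ℝ :=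
  sSup (schnorrRatios k)

/-!
For a KZ reduced factor `R` of size `2 k`, let `D_d` be the squared determinant of its trailing
`d × d` block. By the minimality condition the top left diagonal entry `r` of the block of size
`d + 1` satisfies `r ^ 2 ≤ γ_{d+1} D_{d+1} ^ (1 / (d + 1))` for any upper bound `γ_{d+1}` on the
Hermite constant. As `D_{d+1} = r ^ 2 D_d`, this says
`log D_{d+1} / (d + 1) - log D_d / d ≤ log γ_{d+1} / d`. Summing over `k ≤ d < 2 k` bounds twice
`log D_{2k} / (2 k) - log D_k / k`, which is the logarithm of the ratio in Schnorr's constant, by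
`∑ 2 log γ_{d+1} / d` (`logTail_div_sub_le`).

The constant `0.08698` requires more than Minkowski's convex body theorem. `blichfeldt` proves
`γ_n ≤ (2 / π) Γ (n / 2 + 2) ^ (2 / n)`: if points have mutual distance at least `l`, then the
bumps `(1 - 2 ‖y - p‖² / l²)⁺` centred at them sum to at most `1` everywhere, so that for a lattice
the integral of one bump is at most the covolume. This bound grows like `n / (π e)` with
`π e = 8.539…`, and a Stirling type estimate turns it into
`log γ_{d+1} ≤ log (d / 8.3) + 13 / d` (`log_blichfeldt_le`). The sum of
`(2 / d) (log (d / 8.3) + 13 / d)` is compared with the increment of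
`hermitePrimitive t = log (t / 8.3) ^ 2 - 27 / t` from `k - 1/2` to `2 k - 1/2`, whose main term is
`2 log 2 log (k - 1/2) + (log 2) ^ 2 - 2 log 2 log 8.3` (`hermitePrimitive_sub_le`).
-/

/-! ### Blichfeldt's bound for the minimum of a lattice -/

/-- The identity behind the pointwise estimate: the sum of all squared mutual distances of finitely
many vectors in terms of their norms. -/
theorem sum_sum_norm_sub_sq {α E : Type*} [NormedAddCommGroup E] [InnerProductSpace ℝ E]
    (s : Finset α) (v : α → E) :
    ∑ i ∈ s, ∑ j ∈ s, ‖v i - v j‖ ^ 2 =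
      2 * s.card * ∑ i ∈ s, ‖v i‖ ^ 2 - 2 * ‖∑ i ∈ s, v i‖ ^ 2 := by
  simp_rw [norm_sub_sq_real, Finset.sum_add_distrib, Finset.sum_sub_distrib, ← Finset.mul_sum,
    ← inner_sum, ← sum_inner, real_inner_self_eq_norm_sq, Finset.sum_const, nsmul_eq_mul,
    ← Finset.mul_sum]
  ring

/-- The pointwise estimate in Blichfeldt's argument: for points at mutual distance at least
`l`, the untruncated bumps of radius `l / √2` around them, evaluated at the origin, sum to at most
`1`. -/
theorem sum_one_sub_le_one_of_separated {α E : Type*} [NormedAddCommGroup E]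
    [InnerProductSpace ℝ E] (s : Finset α) (v : α → E) {l : ℝ} (hl : 0 < l)
    (hsep : ∀ i ∈ s, ∀ j ∈ s, i ≠ j → l ≤ ‖v i - v j‖) :
    ∑ i ∈ s, (1 - ‖v i‖ ^ 2 / (l / √2) ^ 2) ≤ 1 := by
  classical
  rcases s.eq_empty_or_nonempty with rfl | hne
  · simp
  have hm : (0 : ℝ) < s.card := by exact_mod_cast hne.card_pos
  have hlow : (s.card : ℝ) * (s.card - 1) * l ^ 2 ≤ ∑ i ∈ s, ∑ j ∈ s, ‖v i - v j‖ ^ 2 := by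
    have hrow : ∀ i ∈ s, ((s.card : ℝ) - 1) * l ^ 2 ≤ ∑ j ∈ s, ‖v i - v j‖ ^ 2 := by
      intro i hi
      rw [← Finset.add_sum_erase s _ hi, sub_self, norm_zero]
      have h := Finset.card_nsmul_le_sum (s.erase i) (fun j => ‖v i - v j‖ ^ 2) (l ^ 2)
        (fun j hj => pow_le_pow_left₀ hl.le
          (hsep i hi j (Finset.mem_of_mem_erase hj) (Finset.ne_of_mem_erase hj).symm) 2)
      rw [nsmul_eq_mul, Finset.card_erase_of_mem hi, Nat.cast_pred hne.card_pos] at h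
      linarith
    have h := Finset.card_nsmul_le_sum s _ _ hrow
    rw [nsmul_eq_mul] at h
    linarith
  rw [sum_sum_norm_sub_sq] at hlow
  have h2 : (s.card : ℝ) * ((s.card - 1) * l ^ 2) ≤ s.card * (2 * ∑ i ∈ s, ‖v i‖ ^ 2) := by
    nlinarith [sq_nonneg ‖∑ i ∈ s, v i‖]
  have h3 := le_of_mul_le_mul_left h2 hm
  have h4 : (s.card : ℝ) - 1 ≤ (∑ i ∈ s, ‖v i‖ ^ 2) / (l / √2) ^ 2 := by
    rw [div_pow, Real.sq_sqrt zero_le_two, le_div_iff₀ (by positivity)]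
    linarith
  rw [Finset.sum_sub_distrib, ← Finset.sum_div]
  simp only [Finset.sum_const, nsmul_eq_mul, mul_one]
  linarith

open MeasureTheory Set in
theorem integral_Ioi_pow_mul_max {n : ℕ} (hn : 0 < n) {r : ℝ} (hr : 0 < r) :
    ∫ y in Ioi (0 : ℝ), y ^ (n - 1) * max (1 - y ^ 2 / r ^ 2) 0 =
      2 * r ^ n / (n * (n + 2)) := by
  obtain ⟨m, rfl⟩ : ∃ m, n = m + 1 := ⟨n - 1, by omega⟩
  have hcut : ∫ y in Ioi (0 : ℝ), y ^ (m + 1 - 1) * max (1 - y ^ 2 / r ^ 2) 0 =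
      ∫ y in Ioc 0 r, y ^ (m + 1 - 1) * max (1 - y ^ 2 / r ^ 2) 0 := by
    refine setIntegral_eq_of_subset_of_forall_sdiff_eq_zero measurableSet_Ioi
      Ioc_subset_Ioi_self fun y hy => ?_
    have h1 : 0 < y := hy.1
    have h2 : r < y := lt_of_not_ge fun h => hy.2 ⟨h1, h⟩
    have h3 : 1 ≤ y ^ 2 / r ^ 2 := by
      rw [one_le_div (by positivity)]
      exact pow_le_pow_left₀ hr.le h2.le 2
    rw [max_eq_right (by linarith), mul_zero]
  have hpoly : ∫ y in Ioc 0 r, y ^ (m + 1 - 1) * max (1 - y ^ 2 / r ^ 2) 0 =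
      ∫ y in Ioc 0 r, (y ^ m - y ^ (m + 2) / r ^ 2) := by
    refine setIntegral_congr_fun measurableSet_Ioc fun y hy => ?_
    have h3 : y ^ 2 / r ^ 2 ≤ 1 := by
      rw [div_le_one (by positivity)]
      exact pow_le_pow_left₀ hy.1.le hy.2 2
    simp only [Nat.add_sub_cancel]
    rw [max_eq_left (by linarith)]
    ring
  rw [hcut, hpoly, ← intervalIntegral.integral_of_le hr.le, intervalIntegral.integral_sub
    (Continuous.intervalIntegrable (by fun_prop) _ _)
    (Continuous.intervalIntegrable (by fun_prop) _ _), intervalIntegral.integral_div,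
    integral_pow, integral_pow]
  push_cast
  field_simp
  ring

open MeasureTheory Set in
/-- The integral of Blichfeldt's bump. Equality holds; the truncation at `0` is done by
`ENNReal.ofReal`. -/
theorem le_lintegral_one_sub_norm_sq {ι : Type*} [Fintype ι] [Nonempty ι] {r : ℝ} (hr : 0 < r) :
    ENNReal.ofReal (r ^ Fintype.card ι * √Real.pi ^ Fintype.card ι /
        Real.Gamma (Fintype.card ι / 2 + 2)) ≤
      ∫⁻ x : EuclideanSpace ℝ ι, ENNReal.ofReal (1 - ‖x‖ ^ 2 / r ^ 2) := by
  have hn : 0 < Fintype.card ι := Fintype.card_pos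
  set n := Fintype.card ι with hn_def
  have hint : ∫ x : EuclideanSpace ℝ ι, max (1 - ‖x‖ ^ 2 / r ^ 2) 0 =
      r ^ n * √Real.pi ^ n / Real.Gamma (n / 2 + 2) := by
    rw [integral_fun_norm_addHaar volume (fun y => max (1 - y ^ 2 / r ^ 2) 0),
      finrank_euclideanSpace, Measure.real, EuclideanSpace.volume_ball, ← hn_def]
    simp only [smul_eq_mul, nsmul_eq_mul]
    have hG1 : 0 < Real.Gamma ((n : ℝ) / 2 + 1) := Real.Gamma_pos_of_pos (by positivity)
    have hG : Real.Gamma ((n : ℝ) / 2 + 2) = (n / 2 + 1) * Real.Gamma (n / 2 + 1) := by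
      rw [← Real.Gamma_add_one (by positivity)]
      congr 1
      ring
    rw [integral_Ioi_pow_mul_max hn hr, hG, ENNReal.ofReal_one, one_pow, one_mul,
      ENNReal.toReal_ofReal (by positivity)]
    have : (0 : ℝ) < n := by exact_mod_cast hn
    field_simp
  rw [← hint, integral_eq_lintegral_of_nonneg_ae
    (f := fun x : EuclideanSpace ℝ ι => max (1 - ‖x‖ ^ 2 / r ^ 2) 0)
    (ae_of_all _ fun x => le_max_right _ _)
    (Continuous.aestronglyMeasurable (by fun_prop))]
  refine ENNReal.ofReal_toReal_le.trans (le_of_eq ?_)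
  refine lintegral_congr fun x => ?_
  simp

open MeasureTheory Set in
/-- **Blichfeldt's bound** for the minimum of the lattice `R ℤⁿ`: the bumps
`(1 - 2 ‖y - p‖² / l²)⁺` at the lattice points `p` sum to at most `1` everywhere, so the integral
of one bump is at most the covolume `|det R|`. -/
theorem blichfeldt {ι : Type*} [Fintype ι] [DecidableEq ι] [Nonempty ι] (R : Matrix ι ι ℝ)
    (hR : R.det ≠ 0) {l : ℝ} (hl : 0 < l)
    (hmin : ∀ x : ι → ℤ, x ≠ 0 → l ≤ ‖WithLp.toLp 2 (R.mulVec (fun j => (x j : ℝ)))‖) :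
    (l / √2) ^ Fintype.card ι * √Real.pi ^ Fintype.card ι /
        Real.Gamma (Fintype.card ι / 2 + 2) ≤ |R.det| := by
  have hr : 0 < l / √2 := by positivity
  set f : (ι → ℝ) → ENNReal :=
    fun y => ENNReal.ofReal (1 - ‖WithLp.toLp 2 y‖ ^ 2 / (l / √2) ^ 2) with hf
  have hfm : Measurable f := by
    have : Continuous fun y : ι → ℝ => 1 - ‖WithLp.toLp 2 y‖ ^ 2 / (l / √2) ^ 2 := by
      have h := PiLp.continuous_toLp 2 (fun _ : ι => ℝ)
      fun_prop
    exact this.measurable.ennreal_ofReal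
  -- The substitution `y = R x`.
  have hsubst : ∫⁻ y, f y = ENNReal.ofReal |R.det| * ∫⁻ x, f (R.mulVec x) := by
    have h := Real.map_matrix_volume_pi_eq_smul_volume_pi hR
    have hm : Measurable (Matrix.toLin' R) :=
      (LinearMap.continuous_of_finiteDimensional _).measurable
    have h2 : ∫⁻ x, f (R.mulVec x) = ∫⁻ y, f y ∂(Measure.map (Matrix.toLin' R) volume) := by
      rw [lintegral_map hfm hm]
      simp
    rw [h2, h, lintegral_smul_measure, smul_eq_mul, ← mul_assoc,
      ← ENNReal.ofReal_mul (abs_nonneg _), ← abs_mul, mul_inv_cancel₀ hR]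
    simp
  -- Unfolding the integral over the translates of the unit cube.
  have hunfold : ∫⁻ x, f (R.mulVec x) ≤ 1 := by
    have hF := ZSpan.isAddFundamentalDomain (Pi.basisFun ℝ ι) (volume : Measure (ι → ℝ))
    have hvol : volume (ZSpan.fundamentalDomain (Pi.basisFun ℝ ι)) = 1 := by
      rw [ZSpan.volume_fundamentalDomain]
      have : Matrix.of (Pi.basisFun ℝ ι) = 1 := by
        ext i j
        simp [Matrix.one_apply, Pi.single_apply, eq_comm]
      rw [this]
      simp
    have : VAddInvariantMeasure (Submodule.span ℤ (Set.range (Pi.basisFun ℝ ι))) (ι → ℝ) volume :=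
      inferInstanceAs (VAddInvariantMeasure
        (Submodule.span ℤ (Set.range (Pi.basisFun ℝ ι))).toAddSubgroup (ι → ℝ) volume)
    have hRm : Measurable fun x : ι → ℝ => R.mulVec x :=
      (LinearMap.continuous_of_finiteDimensional (Matrix.mulVecLin R)).measurable
    rw [hF.lintegral_eq_tsum'' (fun x => f (R.mulVec x)), ← lintegral_tsum
      (f := fun g x => f (R.mulVec (g +ᵥ x)))
      (fun g => ((hfm.comp hRm).comp (measurable_const_vadd g)).aemeasurable)]
    calc _ ≤ ∫⁻ x in ZSpan.fundamentalDomain (Pi.basisFun ℝ ι), 1 := by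
          refine lintegral_mono fun x => ?_
          rw [ENNReal.tsum_eq_iSup_sum]
          refine iSup_le fun s => ?_
          set v : Submodule.span ℤ (Set.range (Pi.basisFun ℝ ι)) → EuclideanSpace ℝ ι :=
            fun g => WithLp.toLp 2 (R.mulVec (g +ᵥ x)) with hv
          have hle : ∑ g ∈ s, f (R.mulVec (g +ᵥ x)) =
              ∑ g ∈ s with 0 < 1 - ‖v g‖ ^ 2 / (l / √2) ^ 2,
                ENNReal.ofReal (1 - ‖v g‖ ^ 2 / (l / √2) ^ 2) := by
            rw [Finset.sum_filter]
            refine Finset.sum_congr rfl fun g _ => ?_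
            split_ifs with h
            · rfl
            · exact ENNReal.ofReal_of_nonpos (not_lt.1 h)
          rw [hle, ← ENNReal.ofReal_sum_of_nonneg fun g hg => (Finset.mem_filter.1 hg).2.le,
            ENNReal.ofReal_le_one]
          -- Differences of translates of `x` are values of `R` at integer vectors.
          refine sum_one_sub_le_one_of_separated _ v hl fun g _ g' _ hgg' => ?_
          have hmem := (g - g').2
          rw [Submodule.mem_span_range_iff_exists_fun] at hmem
          obtain ⟨c, hc⟩ := hmem
          have hc' : (g - g' : ι → ℝ) = fun j => (c j : ℝ) := by
            ext j
            have := congrFun hc j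
            simp [Finset.sum_apply, Pi.single_apply] at this
            simpa using this.symm
          have hc0 : c ≠ 0 := by
            rintro rfl
            apply hgg'
            ext j
            have := congrFun hc' j
            simp at this
            linarith
          have hd : v g - v g' = WithLp.toLp 2 (R.mulVec (fun j => (c j : ℝ))) := by
            rw [← hc', hv]
            simp only [← WithLp.toLp_sub, ← Matrix.mulVec_sub]
            congr 2
            simp [Submodule.vadd_def]
          rw [hd]
          exact hmin c hc0
      _ = 1 := by rw [setLIntegral_one, hvol]
  have hE : ∫⁻ x : EuclideanSpace ℝ ι, ENNReal.ofReal (1 - ‖x‖ ^ 2 / (l / √2) ^ 2) =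
      ∫⁻ y, f y := by
    rw [← (PiLp.volume_preserving_toLp ι).lintegral_comp (by fun_prop)]
  have hfin := le_lintegral_one_sub_norm_sq (ι := ι) hr
  rw [hE, hsubst] at hfin
  have := hfin.trans (mul_le_mul_right hunfold _)
  rw [mul_one] at this
  exact (ENNReal.ofReal_le_ofReal_iff (abs_nonneg _)).1 this

/-! ### Logarithmic estimates -/

theorem inv_le_log_sub_log {d : ℝ} (hd : 1 / 2 < d) :
    1 / d ≤ Real.log (d + 1 / 2) - Real.log (d - 1 / 2) := by
  have h0 : 0 < d - 1 / 2 := by linarith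
  have h1 : 2 * d - 1 ≠ 0 := by linarith
  have h := Real.le_log_one_add_of_nonneg (x := 1 / (d - 1 / 2)) (by positivity)
  have e1 : 1 + 1 / (d - 1 / 2) = (d + 1 / 2) / (d - 1 / 2) := by
    rw [eq_div_iff h0.ne', add_mul, one_div_mul_cancel h0.ne']
    ring
  have e2 : 2 * (1 / (d - 1 / 2)) / (1 / (d - 1 / 2) + 2) = 1 / d := by
    have : 1 / (d - 1 / 2) + 2 = 2 * d / (d - 1 / 2) := by
      rw [eq_div_iff h0.ne', add_mul, one_div_mul_cancel h0.ne']
      ring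
    rw [this]
    have : d ≠ 0 := by linarith
    field_simp
  rwa [e1, e2, Real.log_div (by linarith) h0.ne'] at h

theorem log_sub_log_le {d : ℝ} (hd : 1 / 2 < d) :
    Real.log (d + 1 / 2) - Real.log (d - 1 / 2) ≤ d / (d ^ 2 - 1 / 4) := by
  have h0 : 0 < d - 1 / 2 := by linarith
  have hd0 : 0 < d := by linarith
  have h := Real.log_div_le_sum_range_add (x := 1 / (2 * d)) (by positivity)
    (by rw [div_lt_one (by positivity)]; linarith) 0
  have e1 : (1 + 1 / (2 * d)) / (1 - 1 / (2 * d)) = (d + 1 / 2) / (d - 1 / 2) := by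
    have : 2 * d - 1 ≠ 0 := by linarith
    rw [div_eq_div_iff _ h0.ne']
    · field_simp
    · rw [sub_ne_zero, ne_eq, eq_comm, div_eq_one_iff_eq (by positivity)]
      linarith
  have e2 : (1 / (2 * d)) ^ (2 * 0 + 1) / (1 - (1 / (2 * d)) ^ 2) = d / (d ^ 2 - 1 / 4) / 2 := by
    have h4 : d ^ 2 * 4 - 1 ≠ 0 := by nlinarith
    have : 1 - (1 / (2 * d)) ^ 2 = (d ^ 2 - 1 / 4) / d ^ 2 := by
      field_simp
      ring
    rw [this, mul_zero, zero_add, pow_one]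
    field_simp
  rw [e1, e2, Finset.range_zero, Finset.sum_empty, zero_add,
    Real.log_div (by linarith) h0.ne'] at h
  linarith

/-- A Stirling type bound `Γ (x + 1) ≤ 3 x ^ (x + 1 / 2) e ^ (-x)` for `x = n / 2`. It propagates
from `x` to `x + 1` because `1 ≤ (x + 1 / 2) log ((x + 1) / x)`. -/
theorem log_Gamma_half_le (n : ℕ) (hn : 1 ≤ n) :
    Real.log (Real.Gamma ((n : ℝ) / 2 + 1)) ≤
      Real.log 3 + ((n : ℝ) / 2 + 1 / 2) * Real.log ((n : ℝ) / 2) - (n : ℝ) / 2 := by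
  induction n using Nat.twoStepInduction with
  | zero => omega
  | one =>
    have h1 : Real.Gamma ((1 : ℕ) / 2 + 1) = 1 / 2 * √Real.pi := by
      rw [Nat.cast_one, Real.Gamma_add_one (by norm_num), Real.Gamma_one_half_eq]
    have h2 : Real.log (Real.pi * Real.exp 1) ≤ Real.log (3 * 3) := by
      refine Real.log_le_log (by positivity) ?_
      nlinarith [Real.pi_lt_d2, Real.exp_one_lt_d9, Real.pi_pos, Real.exp_pos 1]
    rw [Real.log_mul (by positivity) (by positivity), Real.log_exp,
      Real.log_mul (by norm_num) (by norm_num)] at h2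
    rw [h1, Real.log_mul (by norm_num) (by positivity), Real.log_sqrt Real.pi_pos.le]
    norm_num
    linarith
  | more n ih _ =>
    rcases Nat.eq_zero_or_pos n with rfl | hpos
    · have h3 : 1 ≤ Real.log 3 := by
        rw [Real.le_log_iff_exp_le (by norm_num)]
        linarith [Real.exp_one_lt_d9]
      have h2 : Real.Gamma (((0 + 2 : ℕ) : ℝ) / 2 + 1) = 1 := by
        norm_num [Real.Gamma_two]
      rw [h2]
      norm_num
      linarith
    · have hx : (0 : ℝ) < (n : ℝ) / 2 := by positivity
      have ih := ih hpos
      have e : ((n + 2 : ℕ) : ℝ) / 2 = (n : ℝ) / 2 + 1 := by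
        push_cast
        ring
      rw [e]
      generalize (n : ℝ) / 2 = x at *
      rw [Real.Gamma_add_one (by positivity),
        Real.log_mul (by positivity) (Real.Gamma_pos_of_pos (by positivity)).ne']
      have h := inv_le_log_sub_log (d := x + 1 / 2) (by linarith)
      rw [div_le_iff₀ (by positivity)] at h
      have e1 : x + 1 / 2 + 1 / 2 = x + 1 := by ring
      have e2 : x + 1 / 2 - 1 / 2 = x := by ring
      rw [e1, e2] at h
      linarith

/-- Blichfeldt's bound `(2 / π) Γ (n / 2 + 2) ^ (2 / n)` for the Hermite constant in dimension
`n = d + 1`, in logarithmic form, against `d / 8.3`. Any constant below `π e = 8.539…` could stand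
in for `8.3`; the lower order terms in `log d / d` are absorbed by the tangent to `log` at `60`. -/
theorem log_blichfeldt_le (d : ℕ) (hd : 1 ≤ d) :
    Real.log 2 - Real.log Real.pi +
        2 / ((d : ℝ) + 1) * Real.log (Real.Gamma (((d : ℝ) + 1) / 2 + 2)) ≤
      Real.log d - Real.log 8.3 + 13 / d := by
  have hd0 : (1 : ℝ) ≤ d := by exact_mod_cast hd
  have hG := log_Gamma_half_le (d + 1) (by omega)
  push_cast at hG
  obtain ⟨x, hx⟩ : ∃ x : ℝ, x = ((d : ℝ) + 1) / 2 := ⟨_, rfl⟩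
  have hx1 : 1 ≤ x := by linarith
  have hx0 : 0 < x := by linarith
  rw [← hx] at hG ⊢
  have hG2 : Real.log (Real.Gamma (x + 2)) =
      Real.log (x + 1) + Real.log (Real.Gamma (x + 1)) := by
    rw [← Real.log_mul (by positivity) (Real.Gamma_pos_of_pos (by positivity)).ne',
      ← Real.Gamma_add_one (by positivity)]
    ring_nf
  have hlog2 := Real.log_two_lt_d9
  have h60 : Real.log 60 ≤ 4.0964 := by
    have h := Real.log_le_sub_one_of_pos (x := 60 / 2 ^ 6) (by norm_num)
    rw [Real.log_div (by norm_num) (by norm_num), Real.log_pow] at h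
    norm_num at h ⊢
    linarith
  have h3 : Real.log 3 ≤ 1.1363 := by
    have h := Real.log_le_sub_one_of_pos (x := 3 / 2 ^ 2) (by norm_num)
    rw [Real.log_div (by norm_num) (by norm_num), Real.log_pow] at h
    norm_num at h ⊢
    linarith
  have htan : Real.log (x + 1) ≤ (x + 1) / 60 - 1 + Real.log 60 := by
    have h := Real.log_le_sub_one_of_pos (x := (x + 1) / 60) (by positivity)
    rw [Real.log_div (by positivity) (by norm_num)] at h
    linarith
  have hmono : Real.log x ≤ Real.log (x + 1) := Real.log_le_log hx0 (by linarith)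
  have hmain : Real.log (Real.Gamma (x + 2)) ≤ x * (Real.log x - 0.975) + 5.81 := by
    rw [hG2]
    linarith
  have hpi : Real.log 8.3 - Real.log Real.pi ≤ 0.975 := by
    have h := Real.log_le_sub_one_of_pos (x := 8.3 / (Real.pi * Real.exp 1)) (by positivity)
    rw [Real.log_div (by norm_num) (by positivity), Real.log_mul (by positivity) (by positivity),
      Real.log_exp] at h
    have h2 : 8.3 / (Real.pi * Real.exp 1) ≤ 0.975 := by
      rw [div_le_iff₀ (by positivity)]
      nlinarith [Real.pi_gt_d2, Real.exp_one_gt_d9]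
    linarith
  have hlogd : Real.log ((d : ℝ) + 1) ≤ Real.log d + 1 / d := by
    have h := Real.log_le_sub_one_of_pos (x := ((d : ℝ) + 1) / d) (by positivity)
    rw [Real.log_div (by positivity) (by positivity)] at h
    have : ((d : ℝ) + 1) / d - 1 = 1 / d := by
      field_simp
      ring
    linarith
  have hlogx : Real.log x = Real.log ((d : ℝ) + 1) - Real.log 2 := by
    rw [hx, Real.log_div (by positivity) (by norm_num)]
  have hfac : 2 / ((d : ℝ) + 1) = 1 / x := by
    rw [hx]
    field_simp
  have hdiv : 1 / x * Real.log (Real.Gamma (x + 2)) ≤ Real.log x - 0.975 + 5.81 / x := by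
    calc _ ≤ 1 / x * (x * (Real.log x - 0.975) + 5.81) := by gcongr
      _ = _ := by field_simp
  have hxd : 5.81 / x ≤ 12 / d := by
    rw [hx, div_le_div_iff₀ (by positivity) (by positivity)]
    linarith
  rw [hfac]
  have : (13 : ℝ) / d = 12 / d + 1 / d := by ring
  linarith

/-- Up to the coefficient of `1 / t`, a primitive of `(2 / t) (log (t / 8.3) + 13 / t)`. An exact primitive
has `26` in place of `27`; the difference pays for crude error terms in the midpoint rule. -/
noncomputable def hermitePrimitive (t : ℝ) : ℝ :=
  (Real.log t - Real.log 8.3) ^ 2 - 27 / t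

/-- A midpoint rule on the interval of length one around `d`. -/
theorem le_hermitePrimitive_sub {d : ℝ} (hd : 5 ≤ d) :
    2 / d * (Real.log d - Real.log 8.3 + 13 / d) ≤
      hermitePrimitive (d + 1 / 2) - hermitePrimitive (d - 1 / 2) := by
  have hlo := inv_le_log_sub_log (d := d) (by linarith)
  have hup := log_sub_log_le (d := d) (by linarith)
  have hd0 : 0 < d := by linarith
  have hm : 0 < d - 1 / 2 := by linarith
  have hq : 0 < d ^ 2 - 1 / 4 := by nlinarith
  have hq' : d ^ 2 * 4 - 1 ≠ 0 := by linarith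
  have hsum : 2 * Real.log d - 1 / 4 / (d ^ 2 - 1 / 4) ≤
      Real.log (d + 1 / 2) + Real.log (d - 1 / 2) := by
    have h := Real.one_sub_inv_le_log_of_pos (x := (d ^ 2 - 1 / 4) / d ^ 2) (by positivity)
    rw [Real.log_div hq.ne' (by positivity), Real.log_pow] at h
    have e1 : Real.log (d ^ 2 - 1 / 4) = Real.log (d + 1 / 2) + Real.log (d - 1 / 2) := by
      rw [← Real.log_mul (by positivity) hm.ne']
      ring_nf
    have e2 : 1 - ((d ^ 2 - 1 / 4) / d ^ 2)⁻¹ = - (1 / 4 / (d ^ 2 - 1 / 4)) := by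
      rw [inv_div]
      field_simp
      ring
    rw [e1, e2] at h
    push_cast at h
    linarith
  have hlow : -1 ≤ Real.log d - Real.log 8.3 := by
    have h := Real.one_sub_inv_le_log_of_pos (x := d / 8.3) (by positivity)
    rw [Real.log_div hd0.ne' (by norm_num), inv_div] at h
    have : 8.3 / d ≤ 2 := by
      rw [div_le_iff₀ hd0]
      linarith
    linarith
  have hfrac : 27 / (d - 1 / 2) - 27 / (d + 1 / 2) = 27 / (d ^ 2 - 1 / 4) := by
    have : d ^ 2 - 1 / 4 = (d - 1 / 2) * (d + 1 / 2) := by ring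
    rw [div_sub_div _ _ hm.ne' (by linarith), this]
    congr 1
    ring
  unfold hermitePrimitive
  generalize Real.log (d + 1 / 2) = a at *
  generalize Real.log (d - 1 / 2) = b at *
  generalize Real.log d = p at *
  generalize Real.log 8.3 = c at *
  have hab : 0 ≤ a - b := le_trans (by positivity) hlo
  -- Both errors of the midpoint rule are `O(d⁻³)`.
  have h1 : (a - b) * (a + b - 2 * p) ≥ -(d / (d ^ 2 - 1 / 4) * (1 / 4 / (d ^ 2 - 1 / 4))) := by
    have := mul_le_mul hup (le_refl (1 / 4 / (d ^ 2 - 1 / 4))) (by positivity) (by positivity)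
    nlinarith
  have h2 : (a - b - 1 / d) * (p - c) ≥ -(d / (d ^ 2 - 1 / 4) - 1 / d) := by
    nlinarith
  have h3 : d / (d ^ 2 - 1 / 4) * (1 / 4 / (d ^ 2 - 1 / 4)) +
      2 * (d / (d ^ 2 - 1 / 4) - 1 / d) + 26 / d ^ 2 ≤ 27 / (d ^ 2 - 1 / 4) := by
    have hk : 27 / (d ^ 2 - 1 / 4) - (d / (d ^ 2 - 1 / 4) * (1 / 4 / (d ^ 2 - 1 / 4)) +
      2 * (d / (d ^ 2 - 1 / 4) - 1 / d) + 26 / d ^ 2) =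
      (27 * d ^ 2 * (d ^ 2 - 1 / 4) - d ^ 3 / 4 - d * (d ^ 2 - 1 / 4) / 2
        - 26 * (d ^ 2 - 1 / 4) ^ 2) / (d ^ 2 * (d ^ 2 - 1 / 4) ^ 2) := by
      field_simp
      ring
    have : 0 ≤ (27 * d ^ 2 * (d ^ 2 - 1 / 4) - d ^ 3 / 4 - d * (d ^ 2 - 1 / 4) / 2
        - 26 * (d ^ 2 - 1 / 4) ^ 2) / (d ^ 2 * (d ^ 2 - 1 / 4) ^ 2) := by
      apply div_nonneg _ (by positivity)
      nlinarith [mul_pos hd0 hd0, mul_pos (mul_pos hd0 hd0) hd0, pow_pos hd0 4,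
        mul_nonneg (pow_pos hd0 3).le (sub_nonneg.2 hd)]
    linarith
  have e : 2 / d * (p - c + 13 / d) = 2 * (1 / d * (p - c)) + 26 / d ^ 2 := by
    field_simp
    ring
  rw [e]
  nlinarith

/-- The increment of the primitive over `[k - 1/2, 2 k - 1/2]` is
`2 log 2 log (k - 1/2) + (log 2) ^ 2 - 2 log 2 log 8.3` up to terms which `18 / k` dominates, and
`exp ((log 2) ^ 2 - 2 log 2 log 8.3) < 0.08698`. -/
theorem hermitePrimitive_sub_le {k : ℝ} (hk : 5 ≤ k) :
    hermitePrimitive (2 * k - 1 / 2) - hermitePrimitive (k - 1 / 2) ≤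
      Real.log 0.08698 + 18 / k + 2 * Real.log 2 * Real.log (k - 1 / 2) := by
  have hl2 := Real.log_two_lt_d9
  have hg2 := Real.log_two_gt_d9
  have hm : 0 < k - 1 / 2 := by linarith
  have h2m : 0 < 2 * k - 1 / 2 := by linarith
  have hy : 0 < 2 * k - 1 := by linarith
  have hc : 2.1155 ≤ Real.log 8.3 := by
    have h := Real.one_sub_inv_le_log_of_pos (x := 8.3 / 2 ^ 3) (by norm_num)
    rw [Real.log_div (by norm_num) (by norm_num), Real.log_pow] at h
    norm_num at h ⊢
    linarith
  have hnum : -2.4425 ≤ Real.log 0.08698 := by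
    have h := Real.one_sub_inv_le_log_of_pos (x := 0.08698 ^ 2 * 2 ^ 7) (by norm_num)
    rw [Real.log_mul (by norm_num) (by norm_num), Real.log_pow, Real.log_pow] at h
    norm_num at h ⊢
    linarith
  have hconst : Real.log 2 ^ 2 - 2 * Real.log 2 * Real.log 8.3 ≤ Real.log 0.08698 - 0.008 := by
    nlinarith
  -- `δ` is the excess of `log ((2 k - 1 / 2) / (k - 1 / 2))` over `log 2`.
  obtain ⟨δ, hδ⟩ : ∃ δ, δ = Real.log (2 * k - 1 / 2) - Real.log (2 * k - 1) := ⟨_, rfl⟩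
  have hδ0 : 0 ≤ δ := by
    rw [hδ, sub_nonneg]
    exact Real.log_le_log hy (by linarith)
  have hδ1 : δ ≤ 1 / 2 / (2 * k - 1) := by
    have h := Real.log_le_sub_one_of_pos (x := (2 * k - 1 / 2) / (2 * k - 1)) (by positivity)
    rw [Real.log_div h2m.ne' hy.ne'] at h
    have : (2 * k - 1 / 2) / (2 * k - 1) - 1 = 1 / 2 / (2 * k - 1) := by
      field_simp
      ring
    linarith
  have hlogy : Real.log (2 * k - 1) = Real.log 2 + Real.log (k - 1 / 2) := by
    rw [← Real.log_mul (by norm_num) hm.ne']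
    ring_nf
  -- The slope `1 / 166` is small enough for `δ` times this bound to fit into the slack `0.008`.
  have hgrow : Real.log (2 * k - 1) - Real.log 8.3 ≤ (2 * k - 1) / 166 + 2.03 := by
    have h := Real.log_le_sub_one_of_pos (x := (2 * k - 1) / (8.3 * (2 ^ 4 * 1.25)))
      (by positivity)
    have h125 := Real.log_le_sub_one_of_pos (x := 1.25) (by norm_num)
    rw [Real.log_div hy.ne' (by norm_num), Real.log_mul (by norm_num) (by norm_num),
      Real.log_mul (by norm_num) (by norm_num), Real.log_pow] at h
    norm_num at h h125 ⊢
    linarith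
  have hprod : δ * (2 * (Real.log (2 * k - 1) - Real.log 8.3) + δ) ≤ 0.008 + 1.2 / k := by
    have hδ2 : δ ≤ 0.06 := hδ1.trans (by rw [div_le_iff₀ hy]; linarith)
    calc δ * (2 * (Real.log (2 * k - 1) - Real.log 8.3) + δ)
        ≤ δ * ((2 * k - 1) / 83 + 4.12) := by
          apply mul_le_mul_of_nonneg_left _ hδ0
          linarith
      _ ≤ 1 / 2 / (2 * k - 1) * ((2 * k - 1) / 83 + 4.12) := by gcongr
      _ = 1 / 166 + 2.06 / (2 * k - 1) := by field_simp; ring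
      _ ≤ 0.008 + 1.2 / k := by
          have : 2.06 / (2 * k - 1) ≤ 1.2 / k := by
            rw [div_le_div_iff₀ hy (by linarith)]
            linarith
          linarith
  have hfrac : 27 / (k - 1 / 2) - 27 / (2 * k - 1 / 2) ≤ 16.8 / k := by
    rw [div_sub_div _ _ hm.ne' h2m.ne', div_le_div_iff₀ (by positivity) (by linarith)]
    nlinarith
  unfold hermitePrimitive
  have hw : Real.log (2 * k - 1 / 2) = Real.log 2 + Real.log (k - 1 / 2) + δ := by linarith
  rw [hw]
  rw [hlogy] at hprod
  have : (18 : ℝ) / k = 1.2 / k + 16.8 / k := by ring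
  nlinarith

/-! ### Trailing blocks of KZ reduced factors and Schnorr's constant -/

theorem abs_det_tailBlock {n : ℕ} {R : Matrix (Fin n) (Fin n) ℝ}
    (hup : ∀ i j : Fin n, j < i → R i j = 0) (i : Fin n) :
    |(tailBlock R i).det| = ∏ j : Fin n with i ≤ j, |R j j| := by
  have h : (tailBlock R i).BlockTriangular id := fun a b hab => hup a b hab
  rw [Matrix.det_of_isUpperTriangular h, Finset.abs_prod,
    Finset.prod_subtype (p := fun j => i ≤ j) _ (by simp)]
  rfl

theorem diag_ne_zero {n : ℕ} {R : Matrix (Fin n) (Fin n) ℝ}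
    (hup : ∀ i j : Fin n, j < i → R i j = 0) (hR : R.det ≠ 0) (j : Fin n) : R j j ≠ 0 := by
  have h : R.BlockTriangular id := fun a b hab => hup a b hab
  rw [Matrix.det_of_isUpperTriangular h] at hR
  exact Finset.prod_ne_zero_iff.1 hR j (Finset.mem_univ j)

/-- Blichfeldt's bound for the lattice generated by the tail block at the index `i`, whose minimum
is `|r_ii|` by the Korkine–Zolotareff condition. -/
theorem two_mul_log_diag_le {n : ℕ} {R : Matrix (Fin n) (Fin n) ℝ}
    (hup : ∀ i j : Fin n, j < i → R i j = 0) (hR : R.det ≠ 0) (hKZ : IsKZReducedFactor R)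
    (i : Fin n) {d : ℕ} (hd : n = i + (d + 1)) :
    2 * Real.log |R i i| ≤ Real.log 2 - Real.log Real.pi +
      2 / ((d : ℝ) + 1) * Real.log (Real.Gamma (((d : ℝ) + 1) / 2 + 2)) +
      (∑ j : Fin n with i ≤ j, 2 * Real.log |R j j|) / ((d : ℝ) + 1) := by
  have hdiag := diag_ne_zero hup hR
  have hl : 0 < |R i i| := abs_pos.2 (hdiag i)
  have hcard : Fintype.card {j : Fin n // i ≤ j} = d + 1 := by
    rw [Fintype.card_subtype]
    have : (Finset.univ.filter fun j => i ≤ j) = Finset.Ici i := by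
      ext
      simp
    rw [this, Fin.card_Ici]
    omega
  have hne : Nonempty {j : Fin n // i ≤ j} := ⟨⟨i, le_rfl⟩⟩
  have hdet : (tailBlock R i).det ≠ 0 := by
    rw [← abs_pos, abs_det_tailBlock hup]
    exact Finset.prod_pos fun j _ => abs_pos.2 (hdiag j)
  have hB := blichfeldt (tailBlock R i) hdet hl
    fun x hx => (hKZ.minimal i).2 ⟨x, hx, rfl⟩
  rw [hcard, abs_det_tailBlock hup] at hB
  push_cast at hB
  have hG : 0 < Real.Gamma (((d : ℝ) + 1) / 2 + 2) := Real.Gamma_pos_of_pos (by positivity)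
  have hlog := Real.log_le_log (by positivity) hB
  have hpi := Real.pi_pos
  rw [Real.log_div (by positivity) hG.ne', Real.log_mul (by positivity) (by positivity),
    Real.log_pow, Real.log_pow, Real.log_div hl.ne' (by positivity), Real.log_sqrt (by norm_num),
    Real.log_sqrt hpi.le, Real.log_prod fun j _ => (abs_pos.2 (hdiag j)).ne'] at hlog
  push_cast at hlog
  rw [← Finset.mul_sum]
  generalize (∑ j : Fin n with i ≤ j, Real.log |R j j|) = S at *
  have hd1 : (0 : ℝ) < d + 1 := by positivity
  have e : 2 / ((d : ℝ) + 1) * Real.log (Real.Gamma (((d : ℝ) + 1) / 2 + 2)) +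
      2 * S / ((d : ℝ) + 1) =
      2 * (Real.log (Real.Gamma (((d : ℝ) + 1) / 2 + 2)) + S) / ((d : ℝ) + 1) := by
    field_simp
  rw [add_assoc, e, ← sub_le_iff_le_add', le_div_iff₀ hd1]
  linarith

/-- The logarithm of the squared determinant of the trailing `e × e` block of a triangular
matrix. -/
noncomputable def logTail {n : ℕ} (R : Matrix (Fin n) (Fin n) ℝ) (e : ℕ) : ℝ :=
  ∑ j : Fin n with n ≤ j.val + e, 2 * Real.log |R j j|

theorem logTail_succ {n : ℕ} (R : Matrix (Fin n) (Fin n) ℝ) (i : Fin n) {d : ℕ}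
    (hd : n = i + (d + 1)) : logTail R (d + 1) = 2 * Real.log |R i i| + logTail R d := by
  unfold logTail
  have hins : (Finset.univ.filter fun j : Fin n => n ≤ j.val + (d + 1)) =
      insert i (Finset.univ.filter fun j : Fin n => n ≤ j.val + d) := by
    ext j
    simp only [Finset.mem_filter, Finset.mem_univ, true_and, Finset.mem_insert, Fin.ext_iff]
    omega
  rw [hins, Finset.sum_insert (by simp; omega)]

/-- Passing from the trailing block of size `d` to that of size `d + 1` increases the logarithm of
the normalized determinant by at most `1 / d` times the logarithm of the Hermite bound in dimension
`d + 1`; these increments telescope. -/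
theorem logTail_div_sub_le {n : ℕ} {R : Matrix (Fin n) (Fin n) ℝ}
    (hup : ∀ i j : Fin n, j < i → R i j = 0) (hR : R.det ≠ 0) (hKZ : IsKZReducedFactor R)
    {k : ℕ} (hk : 5 ≤ k) {d : ℕ} (hkd : k ≤ d) (hdn : d ≤ n) :
    logTail R d / d - logTail R k / k ≤
      (hermitePrimitive ((d : ℝ) - 1 / 2) - hermitePrimitive ((k : ℝ) - 1 / 2)) / 2 := by
  induction d, hkd using Nat.le_induction with
  | base => simp
  | succ d hkd ih =>
    have ih := ih (by omega)
    have hd5 : (5 : ℝ) ≤ d := by exact_mod_cast hk.trans hkd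
    have hd0 : (0 : ℝ) < d := by linarith
    obtain ⟨i, hi⟩ : ∃ i : Fin n, n = i + (d + 1) := ⟨⟨n - (d + 1), by omega⟩, by simp; omega⟩
    have hstep := two_mul_log_diag_le hup hR hKZ i hi
    have htail : (∑ j : Fin n with i ≤ j, 2 * Real.log |R j j|) = logTail R (d + 1) := by
      refine Finset.sum_congr ?_ fun _ _ => rfl
      ext j
      simp only [Finset.mem_filter, Finset.mem_univ, true_and, Fin.le_def]
      omega
    rw [htail] at hstep
    have hH := log_blichfeldt_le d (by omega)
    have hP := le_hermitePrimitive_sub hd5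
    have hsucc := logTail_succ R i hi
    have hlow : logTail R (d + 1) / ((d : ℝ) + 1) - logTail R d / d ≤
        1 / d * (Real.log d - Real.log 8.3 + 13 / d) := by
      have h : logTail R (d + 1) - logTail R d - logTail R (d + 1) / ((d : ℝ) + 1) ≤
          Real.log d - Real.log 8.3 + 13 / d := by linarith
      calc _ = 1 / d * (logTail R (d + 1) - logTail R d - logTail R (d + 1) / ((d : ℝ) + 1)) := by
            field_simp
            ring
        _ ≤ _ := by gcongr
    have e : 2 / (d : ℝ) * (Real.log d - Real.log 8.3 + 13 / d) =
        2 * (1 / d * (Real.log d - Real.log 8.3 + 13 / d)) := by ring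
    push_cast
    have e2 : (d : ℝ) + 1 - 1 / 2 = d + 1 / 2 := by ring
    rw [e2]
    linarith

theorem schnorrRatios_le {k : ℕ} (hk : 5 ≤ k) {b : ℝ} (hb : b ∈ schnorrRatios k) :
    b ≤ 0.08698 * Real.exp (18 / (k : ℝ)) * ((k : ℝ) - 0.5) ^ (2 * Real.log 2) := by
  obtain ⟨m, A, Q, R, -, hQR, hKZ, rfl⟩ := hb
  have hk5 : (5 : ℝ) ≤ k := by exact_mod_cast hk
  have hk0 : (0 : ℝ) < k := by linarith
  have hhalf : (k : ℝ) - 0.5 = k - 1 / 2 := by norm_num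
  have hm : 0 < (k : ℝ) - 1 / 2 := by linarith
  have hdiag := diag_ne_zero hQR.upper hQR.nonsingular
  have hnum : (∏ i : Fin (2 * k) with i.val < k, R i i) ≠ 0 :=
    Finset.prod_ne_zero_iff.2 fun i _ => hdiag i
  have hden : (∏ i : Fin (2 * k) with k ≤ i.val, R i i) ≠ 0 :=
    Finset.prod_ne_zero_iff.2 fun i _ => hdiag i
  have h := logTail_div_sub_le hQR.upper hQR.nonsingular hKZ hk (show k ≤ 2 * k by omega) le_rfl
  have hfin := hermitePrimitive_sub_le hk5
  have htail : logTail R k = 2 * Real.log |∏ i : Fin (2 * k) with k ≤ i.val, R i i| := by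
    rw [logTail, ← Finset.mul_sum, Finset.abs_prod,
      Real.log_prod fun j _ => (abs_pos.2 (hdiag j)).ne']
    congr 1
    refine Finset.sum_congr ?_ fun _ _ => rfl
    ext j
    simp only [Finset.mem_filter, Finset.mem_univ, true_and]
    omega
  have hall : logTail R (2 * k) =
      2 * Real.log |∏ i : Fin (2 * k) with i.val < k, R i i| + logTail R k := by
    rw [htail, logTail, ← Finset.mul_sum, Finset.abs_prod, Finset.abs_prod,
      Real.log_prod fun j _ => (abs_pos.2 (hdiag j)).ne',
      Real.log_prod fun j _ => (abs_pos.2 (hdiag j)).ne', ← mul_add,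
      ← Finset.sum_filter_add_sum_filter_not _ (fun j : Fin (2 * k) => j.val < k)]
    simp
  rw [hhalf]
  refine (Real.rpow_le_iff_le_log (abs_pos.2 (div_ne_zero hnum hden)) (by positivity)).2 ?_
  rw [Real.log_mul (by positivity) (by positivity), Real.log_mul (by norm_num) (by positivity),
    Real.log_exp, Real.log_rpow hm, abs_div, Real.log_div (abs_ne_zero.2 hnum) (abs_ne_zero.2 hden)]
  rw [hall] at h
  push_cast at h
  generalize Real.log |∏ i : Fin (2 * k) with i.val < k, R i i| = p at *
  generalize Real.log |∏ i : Fin (2 * k) with k ≤ i.val, R i i| = q at *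
  rw [htail] at h
  have e : 2 / (k : ℝ) * (p - q) = 2 * ((2 * p + 2 * q) / (2 * k) - 2 * q / k) := by
    field_simp
    ring
  linarith

theorem corollary1 (k : ℕ) (hk : 5 ≤ k) :
    BddAbove (schnorrRatios k) ∧
      schnorrConstant k ≤
        0.08698 * Real.exp (18 / (k : ℝ)) * ((k : ℝ) - 0.5) ^ (2 * Real.log 2) := by
  refine ⟨⟨_, fun b hb => schnorrRatios_le hk hb⟩,
    Real.sSup_le (fun b hb => schnorrRatios_le hk hb) ?_⟩
  have : (5 : ℝ) ≤ k := by exact_mod_cast hk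
  have : (0 : ℝ) ≤ (k : ℝ) - 0.5 := by linarith
  positivity
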